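/- **Proposition 4.1 (Consistency of linear $\Xi(S)$ approximation on signatures $\Phi^M(S)$).** Let $T>0$ and let $\mathcal V=\mathcal V([0,T],\mathbb R)$ be the space of continuous paths of bounded variation $[0,T]\to\mathbb R$, with the supremum norm $\|\cdot\|_\infty$. Fix $t\in[0,T]$ (for instance $t=T$) and let $\Xi(S)=\max_{u\le t}S_u-S_t$ be the drawdown at time $t$. For $M\ge 0$ let $\Phi^M(S)=(\Phi_w(S))_{|w|\le M}$ be the level-$M$ truncated signature over $[0,t]$ of the time-augmented path $X_u=(X^0_u,X^1_u)=(u,S_u)$, i.e. $$\Phi_w(S)=\int_{0<u_1<\dots<u_m\le t}dX^{w_1}_{u_1}\cdots dX^{w_m}_{u_m}$$ for each word $w=(w_1,\dots,w_m)$ in the letters $0,1$ with $m\le M$ (and $\Phi_\emptyset=1$). For a coefficient vector $L=(L_w)_{|w|\le M}$ write $\langle L,\Phi^M(S)\rangle=\sum_w L_w\Phi_w(S)$. Let $\mathcal K\subset\mathcal V$ be compact and let $S_0,S_1,S_2,\dots$ be sample paths in $\mathcal K$ which are dense in $\mathcal K$. Then: 1. (Error bound.) For every $S\in\mathcal V$,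 every $M$, every coefficient vector $L$ of level $M$ and every $k$, $$|\Xi(S)-\langle L,\Phi^M(S)\rangle|\le 2\|S-S_k\|_\infty+|\Xi(S_k)-\langle L,\Phi^M(S_k)\rangle|+|\langle L,\Phi^M(S_k)-\Phi^M(S)\rangle|,$$ and the last term is at most $\sum_w|L_w|\,|\Phi_w(S_k)-\Phi_w(S)|$. 2. (Existence of accurate coefficients.) For every sequence of levels $M(K)\to\infty$ there are coefficient vectors $\hat L_K$ of level $M(K)$ such that $\sup_{S\in\mathcal K}|\Xi(S)-\langle\hat L_K,\Phi^{M(K)}(S)\rangle|\to0$ as $K\to\infty$. In particular $\max_{k\le K}|\Xi(S_k)-\langle\hat L_K,\Phi^{M(K)}(S_k)\rangle|\to 0$. 3. (Consistency.) There is a sequence of levels $M_0(K)\to\infty$ such that the following holds for every sequence of levels with $M(K)\le M_0(K)$ for all $K$. Let $\hat L_K$ be any coefficient vectors of level $M(K)$ that are fitted on the first samples in the sense that $\max_{k\le K}|\Xi(S_k)-\langle\hat L_K,\Phi^{M(K)}(S_k)\rangle|\to0$ as $K\to\infty$. Then, as $K\to\infty$, $$\sup_{S\in\mathcal K}\,|\Xi(S)-\langle\hat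 L_K,\Phi^{M(K)}(S)\rangle|\to0 .$$ Moreover, for every $\varepsilon>0$ and all sufficiently large $K$, for every $S\in\mathcal K$ there is $k\le K$ for which the right-hand side of the bound in 1 (with $M=M(K)$, $L=\hat L_K$) is at most $\varepsilon$ and the signature distance $\sum_{|w|\le M(K)}|\Phi_w(S_k)-\Phi_w(S)|$ is at most $\varepsilon$. -/

import Mathlib

open Set Filter Topology MeasureTheory

noncomputable section

/-- The space `𝒱([0,T], ℝ)` of continuous paths of bounded variation `[0,T] → ℝ`. Being a subtype
of `C([0,T], ℝ)`, it carries the topology of the supremum norm. -/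
abbrev BVPath (T : ℝ) : Type :=
  {S : C(Icc (0 : ℝ) T, ℝ) // BoundedVariationOn S univ}

instance (T : ℝ) : CompactIccSpace (Icc (0 : ℝ) T) :=
  ⟨fun {_ _} => isClosed_Icc.isCompact⟩

/-- The drawdown at time `t`: `Ξ(S)_t = max_{u ≤ t} S_u - S_t`. -/
def drawdown {T : ℝ} (t : Icc (0 : ℝ) T) (S : BVPath T) : ℝ :=
  sSup (S.1 '' Iic t) - S.1 t

/-- The two coordinates of the time-augmented path `X_u = (u, S_u)`:
coordinate `0` is time and coordinate `1` is the path. -/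
def augCoord {T : ℝ} (S : BVPath T) (i : Fin 2) : Icc (0 : ℝ) T → ℝ :=
  if i = 0 then fun u => (u : ℝ) else S.1

theorem augCoord_boundedVariationOn {T : ℝ} (S : BVPath T) (i : Fin 2) :
    BoundedVariationOn (augCoord S i) univ := by
  by_cases hi : i = 0
  · have key : eVariationOn (fun u : Icc (0 : ℝ) T => (u : ℝ)) univ ≤ ENNReal.ofReal T := by
      refine iSup_le fun p => ?_
      obtain ⟨n, u, hu, -⟩ := p
      have h1 : ∀ i, edist ((u (i + 1) : ℝ)) (u i : ℝ)
          = ENNReal.ofReal ((u (i + 1) : ℝ) - u i) := fun i => by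
        have h0 : (u i : ℝ) ≤ u (i + 1) := hu (Nat.le_succ i)
        rw [edist_dist, Real.dist_eq, abs_of_nonneg (sub_nonneg.2 h0)]
      simp only [h1]
      rw [← ENNReal.ofReal_sum_of_nonneg
        (fun i _ => sub_nonneg.2 (show (u i : ℝ) ≤ u (i + 1) from hu (Nat.le_succ i)))]
      apply ENNReal.ofReal_le_ofReal
      rw [Finset.sum_range_sub (fun i => (u i : ℝ))]
      have h2 := (u n).2.2
      have h3 := (u 0).2.1
      linarith
    simpa [augCoord, hi, BoundedVariationOn] using
      (lt_of_le_of_lt key ENNReal.ofReal_lt_top).ne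
  · simpa [augCoord, hi] using S.2

/-- The iterated (Lebesgue-Stieltjes) integral
`∫_{u₁ < ⋯ < u_m ≤ t} dX^{w₁}_{u₁} ⋯ dX^{w_m}_{u_m}` of the time-augmented path `X_u = (u, S_u)`
along the word `w = (w₁, …, w_m)`. -/
def iteratedIntegral {T : ℝ} (S : BVPath T) : (m : ℕ) → (Fin m → Fin 2) → Icc (0 : ℝ) T → ℝ
  | 0, _, _ => 1
  | m + 1, w, t =>
      ∫ᵛ u in Iic t, iteratedIntegral S m (Fin.init w) u
        ∂•(augCoord_boundedVariationOn S (w (Fin.last m))).vectorMeasure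

/-- Words of length at most `M` in the letters `0, 1`: the index set of the level-`M` signature of
a path in the plane. -/
abbrev SigWord (M : ℕ) : Type := Σ m : Fin (M + 1), (Fin (m : ℕ) → Fin 2)

/-- The signature `Φ^M(S) = (1, Φ_1, …, Φ_M)` truncated at level `M` of the time-augmented path
`u ↦ (u, S_u)` over `[0,t]`. -/
def signature {T : ℝ} (t : Icc (0 : ℝ) T) (M : ℕ) (S : BVPath T) : SigWord M → ℝ :=
  fun w => iteratedIntegral S w.1 w.2 t

/-- The pairing `⟨L, x⟩` of a coefficient vector with an element of the truncated signature
space. -/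
def sigPair {M : ℕ} (L x : SigWord M → ℝ) : ℝ := ∑ w, L w * x w

/-- The error `|Ξ(S)_t - ⟨L, Φ^M(S)⟩|` of the linear approximation of drawdown with
coefficients `L`. -/
def approxError {T : ℝ} (t : Icc (0 : ℝ) T) (M : ℕ) (L : SigWord M → ℝ) (S : BVPath T) : ℝ :=
  |drawdown t S - sigPair L (signature t M S)|

/-- The distance `∑_w |Φ^M(S)_w - Φ^M(S')_w|` in the truncated signature space. -/
def sigDist {T : ℝ} (t : Icc (0 : ℝ) T) (M : ℕ) (S S' : BVPath T) : ℝ :=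
  ∑ w, |signature t M S w - signature t M S' w|

end

/-! The error bound is the triangle inequality through a sample, because the drawdown is 2-Lipschitz
in the supremum norm.

Accurate coefficients come from Stone-Weierstrass. Integration by parts turns a product of iterated
integrals into a sum of iterated integrals, so the linear functionals of the signature form an
algebra (`mul_mem_wordSpan`). The supremum norm does not control `dS`, yet these functionals are
continuous: with a single spatial letter, every `dS` can be integrated away, leaving powers of `S -
S₀` and integrals in time (`IsTimeFunctional`). They do not separate paths, but they contain all
moments of `S - S₀` over `[0, t]`. They therefore determine `S - S₀` there, and with it the
drawdown, which is all that `ContinuousMap.mem_topologicalClosure_of_forall_eq` requires.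

For consistency the difficulty is that fitted coefficients carry no a priori bound. At a fixed
level, finitely many sample signatures already span all of them. Small errors at these samples bound
the functional on that span (`exists_bound_of_bound_on_span`), and the span, being closed, contains
every signature from `𝒦`. Compactness then gives, for each level and tolerance, a number of samples
that suffices (`exists_close_sample`); the level only has to grow slowly relative to these
thresholds. -/

theorem ContinuousMap.integrable_of_isFiniteMeasure {X : Type*} [TopologicalSpace X]
    [CompactSpace X] [MeasurableSpace X] [OpensMeasurableSpace X] (ν : Measure X)
    [IsFiniteMeasure ν] (f : C(X, ℝ)) : Integrable f ν :=
  Integrable.of_bound f.continuous.aestronglyMeasurable ‖f‖ (ae_of_all _ f.norm_coe_le_norm)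

/-! ### Indefinite integrals against atomless measures -/

section Primitive

variable {X : Type*} [LinearOrder X] [TopologicalSpace X] [OrderTopology X] [CompactSpace X]
  [SecondCountableTopology X] [MeasurableSpace X] [BorelSpace X]

/-- Dominated convergence: the truncated integrands converge as `u → u₀` except at the point `u₀`,
which is null. -/
theorem continuous_setIntegral_Iic (ν : Measure X) [IsFiniteMeasure ν] [NullSingletonClass ν]
    (f : C(X, ℝ)) : Continuous fun u => ∫ x in Iic u, f x ∂ν := by
  simp_rw [← integral_indicator measurableSet_Iic]
  refine continuous_iff_continuousAt.2 fun u₀ => ?_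
  refine continuousAt_of_dominated (bound := fun _ => ‖f‖) ?_ ?_ (integrable_const _) ?_
  · exact Eventually.of_forall fun u =>
      (f.continuous.aestronglyMeasurable).indicator measurableSet_Iic
  · refine Eventually.of_forall fun u => ae_of_all _ fun x => ?_
    exact (norm_indicator_le_norm_self _ _).trans (f.norm_coe_le_norm x)
  · have h : ∀ᵐ x ∂ν, x ≠ u₀ := by simp [ae_iff]
    filter_upwards [h] with x hx
    rcases lt_or_gt_of_ne hx with h | h
    · refine (continuousAt_const (y := f x)).congr ?_
      filter_upwards [lt_mem_nhds h] with u hu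
      rw [indicator_of_mem (mem_Iic.2 hu.le)]
    · refine (continuousAt_const (y := (0 : ℝ))).congr ?_
      filter_upwards [gt_mem_nhds h] with u hu
      rw [indicator_of_notMem (by simpa using hu)]

/-- The operator `f ↦ (u ↦ ∫_{x ≤ u} f dν)` on continuous functions, for an atomless finite
measure `ν`. -/
noncomputable def MeasureTheory.Measure.primitive (ν : Measure X) [IsFiniteMeasure ν]
    [NullSingletonClass ν] : C(X, ℝ) →L[ℝ] C(X, ℝ) :=
  LinearMap.mkContinuous
    { toFun := fun f => ⟨fun u => ∫ x in Iic u, f x ∂ν, continuous_setIntegral_Iic ν f⟩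
      map_add' := fun f g => by
        ext u
        exact integral_add (f.integrable_of_isFiniteMeasure ν).integrableOn
          (g.integrable_of_isFiniteMeasure ν).integrableOn
      map_smul' := fun c f => by
        ext u
        exact integral_const_mul c _ }
    (ν.real univ) fun f => by
      refine (ContinuousMap.norm_le _ (by positivity)).2 fun u => ?_
      refine (norm_integral_le_of_norm_le_const (ae_of_all _ f.norm_coe_le_norm)).trans ?_
      rw [mul_comm]
      gcongr
      simp only [measureReal_restrict_apply MeasurableSet.univ]
      exact measureReal_mono (subset_univ _)

theorem MeasureTheory.Measure.primitive_apply (ν : Measure X) [IsFiniteMeasure ν] [NullSingletonClass ν]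
    (f : C(X, ℝ)) (u : X) : ν.primitive f u = ∫ x in Iic u, f x ∂ν := rfl

/-- Integration by parts for atomless finite measures. -/
theorem MeasureTheory.Measure.primitive_mul_primitive (μ ν : Measure X) [IsFiniteMeasure μ]
    [NullSingletonClass μ] [IsFiniteMeasure ν] [NullSingletonClass ν] (f g : C(X, ℝ)) :
    μ.primitive f * ν.primitive g
      = μ.primitive (f * ν.primitive g) + ν.primitive (μ.primitive f * g) := by
  ext u
  simp only [ContinuousMap.mul_apply, ContinuousMap.add_apply, primitive_apply]
  set μ' := μ.restrict (Iic u)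
  set ν' := ν.restrict (Iic u)
  have hf : Integrable f μ' := f.integrable_of_isFiniteMeasure μ'
  have hg : Integrable g ν' := g.integrable_of_isFiniteMeasure ν'
  have hfg : Integrable (fun z : X × X => f z.1 * g z.2) (μ'.prod ν') := hf.mul_prod hg
  have hs : MeasurableSet {z : X × X | z.2 ≤ z.1} :=
    measurableSet_le measurable_snd measurable_fst
  -- Fubini: the product is an integral over a square, cut along the diagonal into two triangles.
  -- Each triangle is integrated first in its smaller variable.
  rw [← integral_prod_mul, ← integral_add_compl hs hfg, ← integral_indicator hs,
    ← integral_indicator hs.compl]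
  congr 1
  · rw [integral_prod _ (hfg.indicator hs)]
    refine setIntegral_congr_fun measurableSet_Iic fun x hx => ?_
    have h : ∀ y, indicator {z : X × X | z.2 ≤ z.1} (fun z => f z.1 * g z.2) (x, y)
        = f x * (Iic x).indicator g y := by
      intro y
      by_cases hy : y ≤ x <;> simp [hy]
    simp only [h]
    rw [integral_const_mul, integral_indicator measurableSet_Iic,
      Measure.restrict_restrict measurableSet_Iic, inter_eq_left.2 (Iic_subset_Iic.2 hx)]
  · rw [integral_prod_symm _ (hfg.indicator hs.compl)]
    refine setIntegral_congr_fun measurableSet_Iic fun y hy => ?_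
    have h : ∀ x, indicator {z : X × X | z.2 ≤ z.1}ᶜ (fun z => f z.1 * g z.2) (x, y)
        = (Iio y).indicator f x * g y := by
      intro x
      by_cases hx : x < y
      · simp [hx, hx.not_ge]
      · simp [hx, not_lt.1 hx]
    simp only [h]
    rw [integral_mul_const, integral_indicator measurableSet_Iio,
      Measure.restrict_restrict measurableSet_Iio,
      inter_eq_left.2 (Iio_subset_Iic_self.trans (Iic_subset_Iic.2 hy))]
    -- The second triangle omits the diagonal; without atoms this costs nothing.
    rw [restrict_Iio_eq_restrict_Iic]

/-- A signed measure without atoms. -/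
class SignedMeasure.Atomless (μ : SignedMeasure X) : Prop where
  apply_singleton : ∀ x, μ {x} = 0

/-- The positive part is `μ` restricted to a Hahn set, so its mass at a point is either `0` or the
`μ`-mass of that point. -/
instance (μ : SignedMeasure X) [h : SignedMeasure.Atomless μ] :
    NullSingletonClass μ.toJordanDecomposition.posPart := by
  obtain ⟨s, hs, hpos, hneg, hp, hn⟩ := μ.toJordanDecomposition_spec
  refine ⟨fun x => ?_⟩
  rw [hp, SignedMeasure.toMeasureOfZeroLE_apply _ _ hs (measurableSet_singleton x)]
  have : μ (s ∩ {x}) = 0 := by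
    by_cases hx : x ∈ s
    · rw [inter_eq_right.2 (singleton_subset_iff.2 hx)]; exact h.apply_singleton x
    · rw [inter_singleton_eq_empty.2 hx]; simp
  simp only [this]
  rfl

instance (μ : SignedMeasure X) [h : SignedMeasure.Atomless μ] :
    NullSingletonClass μ.toJordanDecomposition.negPart := by
  obtain ⟨s, hs, hpos, hneg, hp, hn⟩ := μ.toJordanDecomposition_spec
  refine ⟨fun x => ?_⟩
  rw [hn, SignedMeasure.toMeasureOfLEZero_apply _ _ hs.compl (measurableSet_singleton x)]
  have : μ (sᶜ ∩ {x}) = 0 := by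
    by_cases hx : x ∈ sᶜ
    · rw [inter_eq_right.2 (singleton_subset_iff.2 hx)]; exact h.apply_singleton x
    · rw [inter_singleton_eq_empty.2 hx]; simp
  simp only [this, neg_zero]
  rfl

/-- The operator `f ↦ (u ↦ ∫_{x ≤ u} f dμ)` on continuous functions, for an atomless signed
measure `μ`. -/
noncomputable def SignedMeasure.primitive (μ : SignedMeasure X) [SignedMeasure.Atomless μ] :
    C(X, ℝ) →L[ℝ] C(X, ℝ) :=
  μ.toJordanDecomposition.posPart.primitive - μ.toJordanDecomposition.negPart.primitive

theorem SignedMeasure.primitive_mul_primitive (μ ν : SignedMeasure X)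
    [SignedMeasure.Atomless μ] [SignedMeasure.Atomless ν] (f g : C(X, ℝ)) :
    primitive μ f * primitive ν g
      = primitive μ (f * primitive ν g) + primitive ν (primitive μ f * g) := by
  have h (ρ σ : Measure X) [IsFiniteMeasure ρ] [NullSingletonClass ρ] [IsFiniteMeasure σ] [NullSingletonClass σ] :=
    Measure.primitive_mul_primitive ρ σ f g
  simp only [primitive, FunLike.coe_sub, Pi.sub_apply, mul_sub, sub_mul, map_sub, h]
  abel

theorem SignedMeasure.integral_toSignedMeasure_real {X : Type*} [MeasurableSpace X]
    (ν : Measure X) [IsFiniteMeasure ν] (f : X → ℝ) :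
    ∫ᵛ x, f x ∂•ν.toSignedMeasure = ∫ x, f x ∂ν := by
  have hflip : (ContinuousLinearMap.lsmul ℝ ℝ : ℝ →L[ℝ] ℝ →L[ℝ] ℝ)
      = (ContinuousLinearMap.lsmul ℝ ℝ : ℝ →L[ℝ] ℝ →L[ℝ] ℝ).flip := by
    ext
    simp
  rw [hflip, VectorMeasure.integral_toSignedMeasure]

/-- Links the vector-measure integral defining the signature to the Jordan parts, where Fubini and
dominated convergence apply. -/
theorem SignedMeasure.integral_Iic_eq_primitive (μ : SignedMeasure X)
    [SignedMeasure.Atomless μ] (f : C(X, ℝ)) (u : X) :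
    ∫ᵛ x in Iic u, f x ∂•μ = primitive μ f u := by
  set p := μ.toJordanDecomposition.posPart with hp
  set n := μ.toJordanDecomposition.negPart with hn
  have hμ : μ = p.toSignedMeasure - n.toSignedMeasure :=
    μ.toSignedMeasure_toJordanDecomposition.symm
  have hint (ρ : Measure X) [IsFiniteMeasure ρ] :
      VectorMeasure.Integrable ρ.toSignedMeasure ((Iic u).indicator f) := by
    rw [VectorMeasure.Integrable, Measure.variation_toSignedMeasure]
    exact (f.integrable_of_isFiniteMeasure ρ).indicator measurableSet_Iic
  rw [← VectorMeasure.integral_indicator measurableSet_Iic]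
  conv_lhs => rw [hμ]
  rw [VectorMeasure.integral_sub_vectorMeasure (hint p) (hint n),
    integral_toSignedMeasure_real, integral_toSignedMeasure_real,
    integral_indicator measurableSet_Iic, integral_indicator measurableSet_Iic]
  rfl

end Primitive

/-! ### Integration against the time-augmented path -/

section Path

variable {T : ℝ}

theorem continuous_augCoord (S : BVPath T) (i : Fin 2) : Continuous (augCoord S i) := by
  unfold augCoord
  split_ifs
  exacts [continuous_subtype_val, S.1.continuous]

theorem Continuous.leftLim_eq_self {X : Type*} [LinearOrder X] [TopologicalSpace X]
    [OrderTopology X] {f : X → ℝ} (hf : Continuous f) (a : X) : Function.leftLim f a = f a :=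
  hf.continuousAt.continuousWithinAt.leftLim_eq

theorem Continuous.rightLim_eq_self {X : Type*} [LinearOrder X] [TopologicalSpace X]
    [OrderTopology X] {f : X → ℝ} (hf : Continuous f) (a : X) : Function.rightLim f a = f a :=
  hf.continuousAt.continuousWithinAt.rightLim_eq

instance (S : BVPath T) (i : Fin 2) :
    SignedMeasure.Atomless (augCoord_boundedVariationOn S i).vectorMeasure :=
  ⟨fun x => by
    rw [BoundedVariationOn.vectorMeasure_singleton,
      (continuous_augCoord S i).rightLim_eq_self, (continuous_augCoord S i).leftLim_eq_self,
      sub_self]⟩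

/-- Indefinite integration of continuous functions against a coordinate of the time-augmented
path. -/
noncomputable def pathInt (S : BVPath T) (i : Fin 2) :
    C(Icc (0 : ℝ) T, ℝ) →L[ℝ] C(Icc (0 : ℝ) T, ℝ) :=
  SignedMeasure.primitive (augCoord_boundedVariationOn S i).vectorMeasure

theorem pathInt_mul_pathInt (S : BVPath T) (i j : Fin 2) (f g : C(Icc (0 : ℝ) T, ℝ)) :
    pathInt S i f * pathInt S j g
      = pathInt S i (f * pathInt S j g) + pathInt S j (pathInt S i f * g) :=
  SignedMeasure.primitive_mul_primitive _ _ f g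

theorem vectorMeasure_augCoord_Iic (S : BVPath T) (i : Fin 2) (o u : Icc (0 : ℝ) T)
    (ho : (o : ℝ) = 0) :
    (augCoord_boundedVariationOn S i).vectorMeasure (Iic u) = augCoord S i u - augCoord S i o := by
  have h : Iic u = Icc o u := by
    ext x
    simp only [mem_Iic, mem_Icc, iff_and_self]
    intro _
    exact Subtype.coe_le_coe.1 (ho.trans_le x.2.1)
  have hou : o ≤ u := Subtype.coe_le_coe.1 (ho.trans_le u.2.1)
  rw [h, BoundedVariationOn.vectorMeasure_Icc _ hou, (continuous_augCoord S i).rightLim_eq_self,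
    (continuous_augCoord S i).leftLim_eq_self]

theorem pathInt_one (S : BVPath T) (i : Fin 2) (o u : Icc (0 : ℝ) T) (ho : (o : ℝ) = 0) :
    pathInt S i 1 u = augCoord S i u - augCoord S i o := by
  rw [pathInt, ← SignedMeasure.integral_Iic_eq_primitive, ← vectorMeasure_augCoord_Iic S i o u ho]
  set μ : SignedMeasure (Icc (0 : ℝ) T) := (augCoord_boundedVariationOn S i).vectorMeasure
  have : IsFiniteMeasure (VectorMeasure.variation (VectorMeasure.restrict μ (Iic u))) := by
    rw [← SignedMeasure.totalVariation_eq_variation]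
    infer_instance
  simp only [ContinuousMap.one_apply]
  rw [VectorMeasure.integral_const]
  simp [VectorMeasure.restrict_apply _ measurableSet_Iic MeasurableSet.univ]

/-- Lebesgue measure on the interval `[0, T]`. -/
noncomputable def intervalVolume (T : ℝ) : Measure (Icc (0 : ℝ) T) :=
  Measure.comap Subtype.val volume

instance : NullSingletonClass (intervalVolume T) := ⟨fun x => by
  rw [intervalVolume, comap_subtype_coe_apply measurableSet_Icc]; simp⟩

instance : IsFiniteMeasure (intervalVolume T) := ⟨by
  rw [intervalVolume, comap_subtype_coe_apply measurableSet_Icc, image_univ,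
    Subtype.range_coe, Real.volume_Icc]
  exact ENNReal.ofReal_lt_top⟩

theorem vectorMeasure_augCoord_zero (S : BVPath T) :
    (augCoord_boundedVariationOn S 0).vectorMeasure
      = (intervalVolume T).toSignedMeasure := by
  rcases lt_or_ge T 0 with hT | hT
  · have : IsEmpty (Icc (0 : ℝ) T) := by simp [hT]
    ext s hs
    simp [Set.eq_empty_of_isEmpty]
  have key (u : Icc (0 : ℝ) T) : (augCoord_boundedVariationOn S 0).vectorMeasure (Iic u)
      = (intervalVolume T).toSignedMeasure (Iic u) := by
    rw [vectorMeasure_augCoord_Iic S 0 ⟨0, le_rfl, hT⟩ u rfl,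
      Measure.toSignedMeasure_apply_measurable measurableSet_Iic, measureReal_def,
      intervalVolume, comap_subtype_coe_apply measurableSet_Icc]
    have : Subtype.val '' Iic u = Icc (0 : ℝ) u := by
      ext x
      constructor
      · rintro ⟨y, hy, rfl⟩
        exact ⟨y.2.1, hy⟩
      · rintro ⟨h1, h2⟩
        exact ⟨⟨x, h1, h2.trans u.2.2⟩, h2, rfl⟩
    rw [this, Real.volume_Icc, ENNReal.toReal_ofReal (by linarith [u.2.1])]
    simp [augCoord]
  refine VectorMeasure.ext_of_generateFrom (range Iic) ?_ ?_ isPiSystem_Iic ?_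
  · rintro _ ⟨u, rfl⟩
    exact key u
  · rw [← borel_eq_generateFrom_Iic]
    exact BorelSpace.measurable_eq
  · have : (univ : Set (Icc (0 : ℝ) T)) = Iic ⟨T, hT, le_rfl⟩ := by
      ext x
      simpa using Subtype.coe_le_coe.1 x.2.2
    rw [this, key]

theorem pathInt_zero_apply (S : BVPath T) (f : C(Icc (0 : ℝ) T, ℝ)) (u : Icc (0 : ℝ) T) :
    pathInt S 0 f u = ∫ x in Iic u, f x ∂intervalVolume T := by
  rw [pathInt, ← SignedMeasure.integral_Iic_eq_primitive, vectorMeasure_augCoord_zero,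
    ← VectorMeasure.integral_indicator measurableSet_Iic,
    SignedMeasure.integral_toSignedMeasure_real, integral_indicator measurableSet_Iic]

/-- Integration in time is one fixed operator, independent of the path. Both the continuity of the
signature and the recovery of moments rest on this. -/
theorem pathInt_zero_congr (S S' : BVPath T) : pathInt S 0 = pathInt S' 0 := by
  ext f u
  rw [pathInt_zero_apply, pathInt_zero_apply]

/-- The iterated integral along a word as a continuous function of the upper limit. -/
noncomputable def wordInt (S : BVPath T) : (m : ℕ) → (Fin m → Fin 2) → C(Icc (0 : ℝ) T, ℝ)
  | 0, _ => 1
  | m + 1, w => pathInt S (w (Fin.last m)) (wordInt S m (Fin.init w))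

theorem iteratedIntegral_eq_wordInt (S : BVPath T) (m : ℕ) (w : Fin m → Fin 2)
    (u : Icc (0 : ℝ) T) : iteratedIntegral S m w u = wordInt S m w u := by
  induction m generalizing u with
  | zero => rfl
  | succ m ih =>
    rw [iteratedIntegral, wordInt, pathInt, ← SignedMeasure.integral_Iic_eq_primitive]
    simp only [ih]

/-- Vanishing of the moments of a continuous function over `[0, t]` forces it to vanish there. -/
theorem eq_zero_of_setIntegral_mul_polynomial (h : C(Icc (0 : ℝ) T, ℝ)) (t : Icc (0 : ℝ) T)
    (H : ∀ p ∈ polynomialFunctions (Icc (0 : ℝ) T), ∫ x in Iic t, h x * p x ∂intervalVolume T = 0)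
    (ht : h t = 0) : ∀ u ≤ t, h u = 0 := by
  have hsq : ∫ x in Iic t, h x * h x ∂intervalVolume T = 0 := by
    have hcl : IsClosed {g : C(Icc (0 : ℝ) T, ℝ) | ∫ x in Iic t, h x * g x ∂intervalVolume T = 0} := by
      have hc : Continuous fun g : C(Icc (0 : ℝ) T, ℝ) => ∫ x in Iic t, h x * g x ∂intervalVolume T := by
        have h1 : Continuous fun g : C(Icc (0 : ℝ) T, ℝ) =>
            (intervalVolume T).primitive (h * g) t :=
          (ContinuousEvalConst.continuous_eval_const t).comp
            ((ContinuousLinearMap.continuous _).comp (continuous_const.mul continuous_id))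
        exact h1
      exact isClosed_eq hc continuous_const
    -- Polynomials are dense, so `h` is orthogonal to itself on `[0, t]`.
    have hsub : closure (polynomialFunctions (Icc (0 : ℝ) T) : Set C(Icc (0 : ℝ) T, ℝ))
        ⊆ {g | ∫ x in Iic t, h x * g x ∂intervalVolume T = 0} := closure_minimal H hcl
    have htop := polynomialFunctions_closure_eq_top 0 T
    have : h ∈ (polynomialFunctions (Icc (0 : ℝ) T)).topologicalClosure := by simp [htop]
    exact hsub this
  intro u hu
  -- The value at `t` is a separate hypothesis because for `t = 0` the integrals carry no
  -- information; `u < t` makes the interval nondegenerate.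
  rcases hu.eq_or_lt with rfl | hu
  · exact ht
  have hsq' : ∫ x in Icc (0 : ℝ) t, IccExtend (t.2.1.trans t.2.2) h x ^ 2 = 0 := by
    refine Eq.trans ?_ hsq
    rw [intervalVolume]
    have hI : Iic t = Subtype.val ⁻¹' (Iic (t : ℝ)) := rfl
    rw [hI, (MeasurableEmbedding.subtype_coe measurableSet_Icc).restrict_comap]
    have h1 (x : Icc (0 : ℝ) T) : h x * h x = IccExtend (t.2.1.trans t.2.2) h x ^ 2 := by
      rw [IccExtend_val, sq]
    simp only [h1]
    rw [integral_subtype_comap measurableSet_Icc (fun x => IccExtend (t.2.1.trans t.2.2) h x ^ 2),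
      Measure.restrict_restrict measurableSet_Icc]
    congr 2
    ext x
    constructor
    · exact fun hx => ⟨⟨hx.1, hx.2.trans t.2.2⟩, ⟨x, hx.1, hx.2.trans t.2.2⟩, hx.2, rfl⟩
    · rintro ⟨hx, y, hy, rfl⟩
      exact ⟨hx.1, hy⟩
  have hc : Continuous (IccExtend (t.2.1.trans t.2.2) h) := h.continuous.Icc_extend'
  have hae := (setIntegral_eq_zero_iff_of_nonneg_ae (ae_of_all _ fun x => sq_nonneg _)
    (hc.pow 2).continuousOn.integrableOn_Icc).1 hsq'
  have hne : (0 : ℝ) ≠ t := ((u.2.1).trans_lt hu).ne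
  have := Measure.eqOn_Icc_of_ae_eq volume hne hae (hc.pow 2).continuousOn
    continuousOn_const ⟨u.2.1, hu.le⟩
  simpa [IccExtend_of_mem _ _ u.2] using this

end Path

/-! ### The algebra of iterated integrals -/

section Words

variable {T : ℝ}

/-- Functionals of paths with values in the continuous functions of time. -/
abbrev PathFunctional (T : ℝ) : Type := BVPath T → C(Icc (0 : ℝ) T, ℝ)

/-- Linear combinations of iterated integrals. -/
def wordSpan (T : ℝ) : Submodule ℝ (PathFunctional T) :=
  Submodule.span ℝ (range fun w : Σ m : ℕ, (Fin m → Fin 2) => fun S => wordInt S w.1 w.2)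

theorem wordInt_mem_wordSpan (m : ℕ) (w : Fin m → Fin 2) :
    (fun S : BVPath T => wordInt S m w) ∈ wordSpan T :=
  Submodule.subset_span ⟨⟨m, w⟩, rfl⟩

theorem one_mem_wordSpan : (1 : PathFunctional T) ∈ wordSpan T :=
  wordInt_mem_wordSpan 0 Fin.elim0

theorem pathInt_mem_wordSpan (i : Fin 2) {F : PathFunctional T} (hF : F ∈ wordSpan T) :
    (fun S => pathInt S i (F S)) ∈ wordSpan T := by
  induction hF using Submodule.span_induction with
  | mem F hF =>
    obtain ⟨⟨m, w⟩, rfl⟩ := hF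
    have := wordInt_mem_wordSpan (T := T) (m + 1) (Fin.snoc w i)
    simpa only [wordInt, Fin.snoc_last, Fin.init_snoc] using this
  | zero =>
    simp only [Pi.zero_apply, map_zero]
    exact (wordSpan T).zero_mem
  | add F G _ _ hF hG => simpa using! (wordSpan T).add_mem hF hG
  | smul c F _ hF => simpa using! (wordSpan T).smul_mem c hF

/-- Products of iterated integrals are linear combinations of iterated integrals. -/
theorem wordInt_mul_wordInt_mem_wordSpan (n : ℕ) :
    ∀ (m k : ℕ) (w : Fin m → Fin 2) (v : Fin k → Fin 2), m + k ≤ n →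
      (fun S : BVPath T => wordInt S m w * wordInt S k v) ∈ wordSpan T := by
  induction n with
  | zero =>
    intro m k w v h
    obtain rfl : m = 0 := by lia
    simpa only [wordInt, one_mul] using wordInt_mem_wordSpan k v
  | succ n ih =>
    intro m k w v h
    cases m with
    | zero => simpa only [wordInt, one_mul] using wordInt_mem_wordSpan k v
    | succ m =>
      cases k with
      | zero => simpa only [wordInt, mul_one] using wordInt_mem_wordSpan (m + 1) w
      | succ k =>
        -- Shuffle recursion: integration by parts strips the last letter from one of the two words,
        -- lowering the total length.
        have h1 := pathInt_mem_wordSpan (w (Fin.last m))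
          (ih m (k + 1) (Fin.init w) v (by lia))
        have h2 := pathInt_mem_wordSpan (v (Fin.last k))
          (ih (m + 1) k w (Fin.init v) (by lia))
        have h3 := (wordSpan T).add_mem h1 h2
        convert h3 using 1
        funext S
        exact pathInt_mul_pathInt S _ _ _ _

theorem mul_mem_wordSpan {F G : PathFunctional T} (hF : F ∈ wordSpan T) (hG : G ∈ wordSpan T) :
    F * G ∈ wordSpan T := by
  induction hF, hG using Submodule.span_induction₂ with
  | mem_mem F G hF hG =>
    obtain ⟨⟨m, w⟩, rfl⟩ := hF
    obtain ⟨⟨k, v⟩, rfl⟩ := hG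
    exact wordInt_mul_wordInt_mem_wordSpan _ m k w v le_rfl
  | zero_left => simp
  | zero_right => simp
  | add_left F F' G _ _ _ h h' => rw [add_mul]; exact (wordSpan T).add_mem h h'
  | add_right F G G' _ _ _ h h' => rw [mul_add]; exact (wordSpan T).add_mem h h'
  | smul_left c F G _ _ h => rw [smul_mul_assoc]; exact (wordSpan T).smul_mem c h
  | smul_right c F G _ _ h => rw [mul_smul_comm]; exact (wordSpan T).smul_mem c h

/-- A value of a linear combination of iterated integrals is a linear functional of the truncated
signature, at all sufficiently high levels. -/
theorem exists_sigPair_eq (t : Icc (0 : ℝ) T) {F : PathFunctional T} (hF : F ∈ wordSpan T) :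
    ∃ N, ∀ M ≥ N, ∃ L : SigWord M → ℝ, ∀ S, F S t = sigPair L (signature t M S) := by
  classical
  induction hF using Submodule.span_induction with
  | mem F hF =>
    obtain ⟨⟨m, w⟩, rfl⟩ := hF
    refine ⟨m, fun M hM => ⟨Pi.single ⟨⟨m, Nat.lt_succ_of_le hM⟩, w⟩ 1, fun S => ?_⟩⟩
    rw [sigPair, Finset.sum_eq_single ⟨⟨m, Nat.lt_succ_of_le hM⟩, w⟩]
    · simp [signature, iteratedIntegral_eq_wordInt]
    · intro b _ hb
      simp [Pi.single_eq_of_ne hb]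
    · simp
  | zero => exact ⟨0, fun M _ => ⟨0, fun S => by simp [sigPair]⟩⟩
  | add F G _ _ hF hG =>
    obtain ⟨N, hN⟩ := hF
    obtain ⟨N', hN'⟩ := hG
    refine ⟨max N N', fun M hM => ?_⟩
    obtain ⟨L, hL⟩ := hN M ((le_max_left _ _).trans hM)
    obtain ⟨L', hL'⟩ := hN' M ((le_max_right _ _).trans hM)
    refine ⟨L + L', fun S => ?_⟩
    simp only [Pi.add_apply, ContinuousMap.add_apply, hL S, hL' S, sigPair, add_mul,
      Finset.sum_add_distrib]
  | smul c F _ hF =>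
    obtain ⟨N, hN⟩ := hF
    refine ⟨N, fun M hM => ?_⟩
    obtain ⟨L, hL⟩ := hN M hM
    refine ⟨c • L, fun S => ?_⟩
    simp only [Pi.smul_apply, ContinuousMap.smul_apply, hL S, sigPair, smul_eq_mul,
      Finset.mul_sum, mul_assoc]

/-- The increment `S - S₀` of the path, as a functional. -/
noncomputable def increment (S : BVPath T) : C(Icc (0 : ℝ) T, ℝ) := pathInt S 1 1

theorem increment_apply (S : BVPath T) (o u : Icc (0 : ℝ) T) (ho : (o : ℝ) = 0) :
    increment S u = S.1 u - S.1 o := by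
  rw [increment, pathInt_one S 1 o u ho]
  rfl

theorem continuous_increment : Continuous (increment : PathFunctional T) := by
  rcases lt_or_ge T 0 with hT | hT
  · have : IsEmpty (Icc (0 : ℝ) T) := by simp [hT]
    have : (increment : PathFunctional T) = fun _ => 0 := by
      funext S
      ext u
      exact this.elim u
    rw [this]
    exact continuous_const
  · set o : Icc (0 : ℝ) T := ⟨0, le_rfl, hT⟩
    have : (increment : PathFunctional T)
        = fun S => S.1 - ContinuousMap.const _ (S.1 o) := by
      funext S
      ext u
      exact increment_apply S o u rfl
    rw [this]
    refine continuous_subtype_val.sub ?_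
    exact ContinuousMap.continuous_const'.comp
      ((ContinuousEvalConst.continuous_eval_const o).comp continuous_subtype_val)

theorem pathInt_increment_pow (S : BVPath T) (k : ℕ) :
    increment S ^ (k + 1) = ((k : ℝ) + 1) • pathInt S 1 (increment S ^ k) := by
  induction k with
  | zero => simp [increment]
  | succ k ih =>
    -- By induction the second factor integrates to `increment S ^ (k + 1)`.
    have h := pathInt_mul_pathInt S 1 1 1 (((k : ℝ) + 1) • increment S ^ k)
    rw [map_smul, ← ih, one_mul] at h
    change increment S * _ = _ + pathInt S 1 (increment S * _) at h
    rw [pow_succ', h, mul_smul_comm, ← pow_succ', map_smul]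
    push_cast
    module

/-- Functionals built from powers of the increment by integration in time. -/
inductive IsTimeFunctional : PathFunctional T → Prop
  | pow (k : ℕ) : IsTimeFunctional fun S => increment S ^ k
  | pow_mul {F : PathFunctional T} (k : ℕ) : IsTimeFunctional F →
      IsTimeFunctional fun S => increment S ^ k * pathInt S 0 (F S)
  | add {F G : PathFunctional T} : IsTimeFunctional F → IsTimeFunctional G →
      IsTimeFunctional (F + G)
  | smul {F : PathFunctional T} (c : ℝ) : IsTimeFunctional F → IsTimeFunctional (c • F)

/-! ### Continuity of the signature in the supremum norm -/

namespace IsTimeFunctional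

variable {F : PathFunctional T}

theorem increment_pow_mul (hF : IsTimeFunctional F) (j : ℕ) :
    IsTimeFunctional fun S => increment S ^ j * F S := by
  induction hF with
  | pow k => simpa only [← pow_add] using pow (j + k)
  | pow_mul k h _ => simpa only [← pow_add, ← mul_assoc] using pow_mul (j + k) h
  | add _ _ h h' => simpa only [Pi.add_apply, mul_add] using! h.add h'
  | smul c _ h => simpa only [Pi.smul_apply, mul_smul_comm] using! h.smul c

theorem pathInt_zero (hF : IsTimeFunctional F) :
    IsTimeFunctional fun S => pathInt S 0 (F S) := by
  simpa using pow_mul 0 hF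

/-- With `x` the increment and `A = ∫ F du`, integration by parts gives `∫ xᵏ A dx = (xᵏ⁺¹ A - ∫
xᵏ⁺¹ F du) / (k + 1)`, which contains no integral against `dx`. -/
theorem pathInt_one (hF : IsTimeFunctional F) :
    IsTimeFunctional fun S => pathInt S 1 (F S) := by
  induction hF with
  | pow k =>
    convert (pow (T := T) (k + 1)).smul ((k : ℝ) + 1)⁻¹ using 1
    funext S
    rw [Pi.smul_apply, pathInt_increment_pow, inv_smul_smul₀ (by positivity)]
  | @pow_mul F k h _ =>
    have h1 := ((pow_mul (k + 1) h).add
      ((h.increment_pow_mul (k + 1)).pathInt_zero.smul (-1))).smul ((k : ℝ) + 1)⁻¹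
    convert h1 using 1
    funext S
    have hk : ((k : ℝ) + 1) ≠ 0 := by positivity
    have hparts := pathInt_mul_pathInt S 1 0 (increment S ^ k) (F S)
    simp only [Pi.smul_apply, Pi.add_apply, pathInt_increment_pow, smul_mul_assoc, map_smul,
      hparts]
    rw [smul_comm (-1 : ℝ), ← smul_add, inv_smul_smul₀ hk]
    module
  | add _ _ h h' => simpa only [Pi.add_apply, map_add] using! h.add h'
  | smul c _ h => simpa only [Pi.smul_apply, map_smul] using! h.smul c

theorem continuous (hF : IsTimeFunctional F) : Continuous F := by
  induction hF with
  | pow k => exact continuous_increment.pow k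
  | @pow_mul F k _ h =>
    refine (continuous_increment.pow k).mul ?_
    refine continuous_iff_continuousAt.2 fun S₀ => ?_
    have : (fun S => pathInt S 0 (F S)) = fun S => pathInt S₀ 0 (F S) := by
      funext S
      rw [pathInt_zero_congr S S₀]
    rw [this]
    exact ((pathInt S₀ 0).continuous.comp h).continuousAt
  | add _ _ h h' => exact h.add h'
  | smul c _ h => exact h.const_smul c

end IsTimeFunctional

theorem isTimeFunctional_wordInt (m : ℕ) (w : Fin m → Fin 2) :
    IsTimeFunctional fun S : BVPath T => wordInt S m w := by
  induction m with
  | zero => simpa only [wordInt, pow_zero] using IsTimeFunctional.pow 0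
  | succ m ih =>
    simp only [wordInt]
    obtain h | h : w (Fin.last m) = 0 ∨ w (Fin.last m) = 1 := by
      generalize w (Fin.last m) = i
      fin_cases i <;> simp
    · rw [h]; exact (ih _).pathInt_zero
    · rw [h]; exact (ih _).pathInt_one

/-- The signature of the time-augmented path is continuous in the supremum norm. -/
theorem continuous_signature (t : Icc (0 : ℝ) T) (M : ℕ) :
    Continuous (signature t M) := by
  refine continuous_pi fun w => ?_
  simp only [signature, iteratedIntegral_eq_wordInt]
  exact (ContinuousEvalConst.continuous_eval_const t).comp
    (isTimeFunctional_wordInt _ w.2).continuous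

theorem continuous_apply_of_mem_wordSpan (t : Icc (0 : ℝ) T) {F : PathFunctional T}
    (hF : F ∈ wordSpan T) : Continuous fun S => F S t := by
  obtain ⟨N, hN⟩ := exists_sigPair_eq t hF
  obtain ⟨L, hL⟩ := hN N le_rfl
  simp only [hL, sigPair]
  exact continuous_finsetSum _ fun w _ =>
    continuous_const.mul ((continuous_apply w).comp (continuous_signature t N))

/-- The time coordinate is the iterated integral of the one-letter word `0`; its powers follow from
closure under products. -/
theorem coe_mem_wordSpan (hT : 0 ≤ T) (p : C(Icc (0 : ℝ) T, ℝ))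
    (hp : p ∈ polynomialFunctions (Icc (0 : ℝ) T)) : (fun _ => p) ∈ wordSpan T := by
  have hclock : (fun _ => ⟨Subtype.val, continuous_subtype_val⟩ : PathFunctional T)
      ∈ wordSpan T := by
    convert pathInt_mem_wordSpan 0 (one_mem_wordSpan (T := T)) using 1
    funext S
    ext u
    rw [Pi.one_apply, _root_.pathInt_one S 0 ⟨0, le_rfl, hT⟩ u rfl]
    simp [augCoord]
  obtain ⟨q, -, rfl⟩ := hp
  induction q using Polynomial.induction_on' with
  | add q r hq hr =>
    convert (wordSpan T).add_mem hq hr using 1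
    funext S
    ext u
    simp
  | monomial n a =>
    have hpow (n : ℕ) : (fun _ => ⟨Subtype.val, continuous_subtype_val⟩ ^ n : PathFunctional T)
        ∈ wordSpan T := by
      induction n with
      | zero => simpa using! one_mem_wordSpan
      | succ n ih => simpa only [pow_succ] using! mul_mem_wordSpan ih hclock
    convert (wordSpan T).smul_mem a (hpow n) using 1
    funext S
    ext u
    simp

/-- Paths with equal signatures have equal increments. -/
theorem increment_eq_of_signature_eq (t : Icc (0 : ℝ) T) {S S' : BVPath T}
    (h : ∀ F ∈ wordSpan T, F S t = F S' t) (u : Icc (0 : ℝ) T) (hu : u ≤ t) :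
    increment S u = increment S' u := by
  have hT : 0 ≤ T := t.2.1.trans t.2.2
  have hx : (increment : PathFunctional T) ∈ wordSpan T :=
    pathInt_mem_wordSpan 1 one_mem_wordSpan
  rw [← sub_eq_zero]
  refine eq_zero_of_setIntegral_mul_polynomial (increment S - increment S') t
    (fun p hp => ?_) (sub_eq_zero.2 (h _ hx)) u hu
  -- The moment `∫ (S - S₀) p du` over `[0, t]` is itself a linear functional of the signature.
  have h1 := h _ (pathInt_mem_wordSpan 0 (mul_mem_wordSpan hx (coe_mem_wordSpan hT p hp)))
  rw [pathInt_zero_congr S' S, ← sub_eq_zero, ← ContinuousMap.sub_apply, ← map_sub,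
    pathInt_zero_apply] at h1
  refine Eq.trans ?_ h1
  congr 1
  funext x
  simp [sub_mul]

end Words

/-- **Stone-Weierstrass theorem** without separation of points: a continuous function on a compact
space which is constant on the common level sets of a subalgebra is a uniform limit of elements of
the subalgebra. -/
theorem ContinuousMap.mem_topologicalClosure_of_forall_eq {K : Type*} [TopologicalSpace K]
    [CompactSpace K] (A : Subalgebra ℝ C(K, ℝ)) (ξ : C(K, ℝ))
    (h : ∀ x y, (∀ a ∈ A, a x = a y) → ξ x = ξ y) : ξ ∈ A.topologicalClosure := by
  -- Points not separated by `A` are identified by passing to the image of `E`. This image is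
  -- compact Hausdorff, `ξ` descends to it, and there the functions coming from `A` do separate
  -- points.
  set E : K → (A → ℝ) := fun x a => a.1 x with hE
  have hEc : Continuous E := continuous_pi fun a => a.1.continuous
  set Z := range E with hZ
  have : CompactSpace Z := isCompact_iff_compactSpace.1 (isCompact_range hEc)
  let e : C(K, Z) := ⟨rangeFactorization E, hEc.subtype_mk _⟩
  have hq : IsQuotientMap e :=
    IsQuotientMap.of_surjective_continuous rangeFactorization_surjective e.continuous
  have hfac (x y : K) (hxy : e x = e y) : ξ x = ξ y :=
    h x y fun a ha => congrFun (congrArg Subtype.val hxy) ⟨a, ha⟩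
  let ξ' : C(Z, ℝ) := hq.lift ξ hfac
  have hξ' : ξ'.comp e = ξ := hq.lift_comp ξ hfac
  let B : Subalgebra ℝ C(Z, ℝ) := A.comap (ContinuousMap.compRightAlgHom ℝ ℝ e)
  have hB : B.SeparatesPoints := by
    intro x y hxy
    obtain ⟨a, ha⟩ : ∃ a, x.1 a ≠ y.1 a := by
      by_contra! hcon
      exact hxy (Subtype.ext (funext hcon))
    refine ⟨_, ⟨⟨fun z => z.1 a, (continuous_apply a).comp continuous_subtype_val⟩, ?_, rfl⟩, ha⟩
    exact a.2
  have htop := ContinuousMap.subalgebra_topologicalClosure_eq_top_of_separatesPoints B hB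
  have hmem : ξ' ∈ closure (B : Set C(Z, ℝ)) := by
    have : ξ' ∈ B.topologicalClosure := by simp [htop]
    exact this
  rw [← hξ']
  exact map_mem_closure (f := fun b : C(Z, ℝ) => b.comp e) (ContinuousMap.continuous_precomp e) hmem
    fun b hb => hb

/-! ### The drawdown and its uniform approximation -/

section Drawdown

variable {T : ℝ}

/-- In this form only differences of path values up to `t` enter, and these are what the signature
determines. -/
theorem drawdown_eq_sSup (t : Icc (0 : ℝ) T) (S : BVPath T) :
    drawdown t S = sSup ((fun u => S.1 u - S.1 t) '' Iic t) := by
  have hb : BddAbove (S.1 '' Iic t) := (isCompact_range S.1.continuous).bddAbove.mono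
    (image_subset_range _ _)
  have hne : (S.1 '' Iic t).Nonempty := ⟨_, t, self_mem_Iic, rfl⟩
  have h := (isLUB_csSup hne hb)
  refine (IsLUB.csSup_eq (a := drawdown t S) ?_ ⟨_, mem_image_of_mem _ self_mem_Iic⟩).symm
  refine ⟨?_, fun b hb' => ?_⟩
  · rintro _ ⟨u, hu, rfl⟩
    exact sub_le_sub_right (h.1 ⟨u, hu, rfl⟩) _
  · refine sub_le_iff_le_add.2 (h.2 ?_)
    rintro _ ⟨u, hu, rfl⟩
    exact sub_le_iff_le_add.1 (hb' ⟨u, hu, rfl⟩)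

theorem drawdown_le_add (t : Icc (0 : ℝ) T) (S S' : BVPath T) :
    drawdown t S ≤ drawdown t S' + 2 * ‖S.1 - S'.1‖ := by
  have hb : BddAbove (S'.1 '' Iic t) := (isCompact_range S'.1.continuous).bddAbove.mono
    (image_subset_range _ _)
  have hd (u : Icc (0 : ℝ) T) : |S.1 u - S'.1 u| ≤ ‖S.1 - S'.1‖ :=
    (S.1 - S'.1).norm_coe_le_norm u
  have h : sSup (S.1 '' Iic t) ≤ sSup (S'.1 '' Iic t) + ‖S.1 - S'.1‖ := by
    refine csSup_le ⟨_, t, self_mem_Iic, rfl⟩ ?_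
    rintro _ ⟨u, hu, rfl⟩
    have h1 := le_csSup hb ⟨u, hu, rfl⟩
    have h2 := (abs_le.1 (hd u)).2
    linarith
  have h2 := (abs_le.1 (hd t)).1
  simp only [drawdown]
  linarith

/-- The drawdown is `2`-Lipschitz in the supremum norm. -/
theorem abs_drawdown_sub_le (t : Icc (0 : ℝ) T) (S S' : BVPath T) :
    |drawdown t S - drawdown t S'| ≤ 2 * ‖S.1 - S'.1‖ := by
  have h1 := drawdown_le_add t S S'
  have h2 := drawdown_le_add t S' S
  rw [norm_sub_rev] at h2
  exact abs_le.2 ⟨by linarith, by linarith⟩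

theorem continuous_drawdown (t : Icc (0 : ℝ) T) : Continuous (drawdown (T := T) t) := by
  refine (LipschitzWith.of_dist_le_mul (K := 2) fun S S' => ?_).continuous
  rw [Real.dist_eq, Subtype.dist_eq, dist_eq_norm]
  exact abs_drawdown_sub_le t S S'

theorem drawdown_eq_of_signature_eq (t : Icc (0 : ℝ) T) {S S' : BVPath T}
    (h : ∀ F ∈ wordSpan T, F S t = F S' t) : drawdown t S = drawdown t S' := by
  rw [drawdown_eq_sSup, drawdown_eq_sSup]
  congr 1
  refine image_congr fun u hu => ?_
  let o : Icc (0 : ℝ) T := ⟨0, le_rfl, t.2.1.trans t.2.2⟩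
  have h1 := increment_eq_of_signature_eq t h u hu
  have h2 := increment_eq_of_signature_eq t h t le_rfl
  simp only [increment_apply _ o _ rfl] at h1 h2
  linarith

/-- The restrictions to `𝒦` of the linear functionals of the signature form an algebra. -/
noncomputable def signatureAlgebra (t : Icc (0 : ℝ) T) (𝒦 : Set (BVPath T)) :
    Subalgebra ℝ C(𝒦, ℝ) where
  carrier := {a | ∃ F ∈ wordSpan T, ∀ S : 𝒦, a S = F S t}
  mul_mem' := by
    rintro a b ⟨F, hF, ha⟩ ⟨G, hG, hb⟩
    exact ⟨F * G, mul_mem_wordSpan hF hG, fun S => by simp [ha, hb]⟩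
  add_mem' := by
    rintro a b ⟨F, hF, ha⟩ ⟨G, hG, hb⟩
    exact ⟨F + G, (wordSpan T).add_mem hF hG, fun S => by simp [ha, hb]⟩
  algebraMap_mem' c :=
    ⟨c • 1, (wordSpan T).smul_mem c one_mem_wordSpan, fun S => by simp⟩

/-- Linear functionals of the signature approximate the drawdown uniformly on compact sets. -/
theorem exists_approxError_le (t : Icc (0 : ℝ) T) {𝒦 : Set (BVPath T)} (h𝒦 : IsCompact 𝒦)
    {ε : ℝ} (hε : 0 < ε) :
    ∃ N, ∀ M ≥ N, ∃ L : SigWord M → ℝ, ∀ X ∈ 𝒦, approxError t M L X ≤ ε := by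
  have : CompactSpace 𝒦 := isCompact_iff_compactSpace.1 h𝒦
  let ξ : C(𝒦, ℝ) := ⟨fun S => drawdown t S, (continuous_drawdown t).comp continuous_subtype_val⟩
  have hξ : ξ ∈ (signatureAlgebra t 𝒦).topologicalClosure := by
    refine ContinuousMap.mem_topologicalClosure_of_forall_eq _ ξ fun x y hxy => ?_
    refine drawdown_eq_of_signature_eq t fun F hF => ?_
    exact hxy ⟨fun S => F S t, (continuous_apply_of_mem_wordSpan t hF).comp
      continuous_subtype_val⟩ ⟨F, hF, fun S => rfl⟩
  obtain ⟨a, ⟨F, hF, ha⟩, hd⟩ := Metric.mem_closure_iff.1 hξ ε hε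
  obtain ⟨N, hN⟩ := exists_sigPair_eq t hF
  refine ⟨N, fun M hM => ?_⟩
  obtain ⟨L, hL⟩ := hN M hM
  refine ⟨L, fun X hX => ?_⟩
  have h := (ContinuousMap.dist_apply_le_dist (f := ξ) (g := a) ⟨X, hX⟩).trans hd.le
  rwa [ha, hL, Real.dist_eq] at h

/-- Near-minimisers of a real function exist simultaneously for all upper bounds. -/
theorem exists_near_optimal {α β : Type*} [Nonempty α] (e : α → β → ℝ) (s : Set β)
    (hs : s.Nonempty) (he : ∀ a, ∀ x ∈ s, 0 ≤ e a x) {δ : ℝ} (hδ : 0 < δ) :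
    ∃ a, ∀ ε, (∃ b, ∀ x ∈ s, e b x ≤ ε) → ∀ x ∈ s, e a x ≤ ε + δ := by
  set Q : Set ℝ := {ε | ∃ b, ∀ x ∈ s, e b x ≤ ε}
  rcases Q.eq_empty_or_nonempty with hQ | hQ
  · refine ⟨Classical.arbitrary α, fun ε hε => ?_⟩
    have : ε ∈ Q := hε
    simp [hQ] at this
  · have hbdd : BddBelow Q := by
      obtain ⟨x, hx⟩ := hs
      exact ⟨0, fun ε ⟨b, hb⟩ => (he b x hx).trans (hb x hx)⟩
    obtain ⟨ε', ⟨a, ha⟩, hlt⟩ := exists_lt_of_csInf_lt hQ (lt_add_of_pos_right (sInf Q) hδ)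
    refine ⟨a, fun ε hε x hx => ?_⟩
    have h1 : sInf Q ≤ ε := csInf_le hbdd hε
    linarith [ha x hx]

/-- The coefficients must not depend on `ε`, so near-minimisers of the uniform error are taken at
each level, with slack `1 / (K + 1)`. -/
theorem exists_accurate_coefficients (t : Icc (0 : ℝ) T) {𝒦 : Set (BVPath T)}
    (h𝒦 : IsCompact 𝒦) (hne : 𝒦.Nonempty) {M : ℕ → ℕ} (hM : Tendsto M atTop atTop) :
    ∃ L : (K : ℕ) → SigWord (M K) → ℝ,
      ∀ ε > 0, ∀ᶠ K in atTop, ∀ X ∈ 𝒦, approxError t (M K) (L K) X ≤ ε := by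
  have h (K : ℕ) := exists_near_optimal (approxError t (M K)) 𝒦 hne (fun _ _ _ => abs_nonneg _)
    (Nat.one_div_pos_of_nat (α := ℝ) (n := K))
  choose L hL using h
  refine ⟨L, fun ε hε => ?_⟩
  obtain ⟨N, hN⟩ := exists_approxError_le t h𝒦 (half_pos hε)
  filter_upwards [hM.eventually_ge_atTop N,
    tendsto_one_div_add_atTop_nhds_zero_nat.eventually_lt_const (half_pos hε)] with K h1 h2 X hX
  have := hL K (ε / 2) (hN _ h1) X hX
  linarith

theorem sigPair_sub {M : ℕ} (L x y : SigWord M → ℝ) :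
    sigPair L (x - y) = sigPair L x - sigPair L y := by
  simp [sigPair, mul_sub]

theorem approxError_le (t : Icc (0 : ℝ) T) (M : ℕ) (L : SigWord M → ℝ) (X Y : BVPath T) :
    approxError t M L X ≤ 2 * ‖X.1 - Y.1‖ + approxError t M L Y
      + |sigPair L (signature t M Y - signature t M X)| := by
  have h1 := abs_drawdown_sub_le t X Y
  have h2 : drawdown t X - sigPair L (signature t M X)
      = (drawdown t X - drawdown t Y) + (drawdown t Y - sigPair L (signature t M Y))
        + sigPair L (signature t M Y - signature t M X) := by
    rw [sigPair_sub]
    ring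
  rw [approxError, h2]
  refine (abs_add_three _ _ _).trans ?_
  simp only [approxError]
  linarith

theorem abs_sigPair_le {M : ℕ} (L x : SigWord M → ℝ) : |sigPair L x| ≤ ∑ w, |L w| * |x w| := by
  refine (Finset.abs_sum_le_sum_abs _ _).trans_eq ?_
  simp only [abs_mul]

end Drawdown

/-- Linear functionals that are bounded on sufficiently many of the vectors `v k` are bounded on
the span of all of them, uniformly. -/
theorem exists_bound_of_bound_on_span {ι : Type*} [Fintype ι] (v : ℕ → ι → ℝ) :
    ∃ N : ℕ, ∃ A : ℝ, 0 ≤ A ∧ ∀ (L : ι → ℝ) (C : ℝ), (∀ k ≤ N, |∑ i, L i * v k i| ≤ C) →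
      ∀ x ∈ Submodule.span ℝ (range v), |∑ i, L i * x i| ≤ A * C * ‖x‖ := by
  set W := Submodule.span ℝ (range v) with hW
  obtain ⟨s, hs, hspan⟩ : ∃ s : Finset (ι → ℝ), ↑s ⊆ range v ∧ Submodule.span ℝ (s : Set _) = W := by
    obtain ⟨s, hs, h⟩ := Submodule.fg_span_iff_fg_span_finset_subset (R := ℝ) (range v) |>.1
      (IsNoetherian.noetherian _)
    exact ⟨s, hs, h.symm⟩
  choose! κ hκ using fun x (hx : x ∈ s) => hs hx
  set N := s.sup κ
  set f : (Fin (N + 1) → ℝ) →ₗ[ℝ] (ι → ℝ) := Fintype.linearCombination ℝ fun k => v k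
  have hle : W ≤ LinearMap.range f := by
    rw [← hspan, Submodule.span_le]
    intro x hx
    refine ⟨Pi.single ⟨κ x, Nat.lt_succ_of_le (Finset.le_sup hx)⟩ 1, ?_⟩
    rw [Fintype.linearCombination_apply_single]
    simpa using hκ x hx
  -- A linear right inverse is automatically continuous here, so vectors of the span are
  -- combinations of `v 0, …, v N` with coefficients bounded by `‖g'‖ * ‖x‖`.
  obtain ⟨g, hg⟩ := f.rangeRestrict.exists_rightInverse_of_surjective f.range_rangeRestrict
  set g' := LinearMap.toContinuousLinearMap g
  refine ⟨N, (N + 1) * ‖g'‖, by positivity, fun L C hL x hx => ?_⟩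
  have hfx : f (g' ⟨x, hle hx⟩) = x :=
    congrArg Subtype.val (LinearMap.congr_fun hg ⟨x, hle hx⟩)
  set c := g' ⟨x, hle hx⟩ with hc
  have hcx : ‖c‖ ≤ ‖g'‖ * ‖x‖ := g'.le_opNorm _
  have hC : 0 ≤ C := (abs_nonneg _).trans (hL 0 (Nat.zero_le _))
  have hexp : ∑ i, L i * x i = ∑ k, c k * ∑ i, L i * v k i := by
    rw [← hfx]
    simp only [f, Fintype.linearCombination_apply, Finset.sum_apply, Pi.smul_apply, smul_eq_mul,
      Finset.mul_sum]
    rw [Finset.sum_comm]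
    exact Finset.sum_congr rfl fun k _ => Finset.sum_congr rfl fun i _ => by ring
  calc |∑ i, L i * x i| ≤ ∑ k, |c k * ∑ i, L i * v k i| := by
        rw [hexp]; exact Finset.abs_sum_le_sum_abs _ _
    _ ≤ ∑ _k : Fin (N + 1), ‖g'‖ * ‖x‖ * C := by
        refine Finset.sum_le_sum fun k _ => ?_
        rw [abs_mul]
        exact mul_le_mul ((norm_le_pi_norm c k).trans hcx)
          (hL k (Nat.lt_succ_iff.1 k.2)) (abs_nonneg _) (by positivity)
    _ = (N + 1) * ‖g'‖ * C * ‖x‖ := by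
        rw [Finset.sum_const, Finset.card_univ, Fintype.card_fin, nsmul_eq_mul]
        push_cast
        ring

/-! ### Consistency of fitted coefficients -/

section Consistency

variable {T : ℝ}

theorem continuous_sigDist (t : Icc (0 : ℝ) T) (M : ℕ) (Y : BVPath T) :
    Continuous (sigDist t M Y) := by
  unfold sigDist
  exact continuous_finsetSum _ fun w _ =>
    (continuous_const.sub ((continuous_apply w).comp (continuous_signature t M))).abs

/-- Coefficients with bounded errors on sufficiently many of the samples have nearly equal values
at an arbitrary path and at some sample close to it. -/
theorem exists_close_sample (t : Icc (0 : ℝ) T) {𝒦 : Set (BVPath T)} (h𝒦 : IsCompact 𝒦)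
    {S : ℕ → BVPath T} (hS : ∀ k, S k ∈ 𝒦) (hdense : 𝒦 ⊆ closure (range S)) (M : ℕ)
    {η : ℝ} (hη : 0 < η) :
    ∃ N, ∀ K ≥ N, ∀ L : SigWord M → ℝ, (∀ k ≤ K, approxError t M L (S k) ≤ 1) →
      ∀ X ∈ 𝒦, ∃ k ≤ K, ‖X.1 - (S k).1‖ ≤ η ∧ sigDist t M (S k) X ≤ η ∧
        |sigPair L (signature t M (S k) - signature t M X)| ≤ η := by
  obtain ⟨N₁, A, hA, hbound⟩ := exists_bound_of_bound_on_span fun k => signature t M (S k)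
  set W := Submodule.span ℝ (range fun k => signature t M (S k))
  have hmem : ∀ X ∈ 𝒦, signature t M X ∈ W := fun X hX => by
    have h1 : signature t M X ∈ closure (W : Set (SigWord M → ℝ)) :=
      map_mem_closure (continuous_signature t M) (hdense hX) (by
        rintro _ ⟨k, rfl⟩
        exact Submodule.subset_span ⟨k, rfl⟩)
    rwa [W.closed_of_finiteDimensional.closure_eq] at h1
  obtain ⟨D, hD⟩ := h𝒦.exists_bound_of_continuousOn (continuous_drawdown t).continuousOn
  have hD0 : 0 ≤ D := (norm_nonneg _).trans (hD _ (hS 0))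
  -- Error at most `1` and drawdown at most `D` bound the functional by `1 + D` on the samples; the
  -- extra `1` keeps the denominator positive.
  set δ := η / (A * (1 + D) + 1) with hδ
  have hpos : 0 < A * (1 + D) + 1 := by positivity
  have hδ0 : 0 < δ := div_pos hη hpos
  set U : ℕ → Set (BVPath T) := fun k => {X | ‖X.1 - (S k).1‖ < η ∧ sigDist t M (S k) X < η ∧
    ‖signature t M (S k) - signature t M X‖ < δ} with hU
  have hUo (k : ℕ) : IsOpen (U k) :=
    (isOpen_lt (continuous_subtype_val.sub continuous_const).norm continuous_const).inter
      ((isOpen_lt (continuous_sigDist t M _) continuous_const).inter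
        (isOpen_lt (continuous_const.sub (continuous_signature t M)).norm continuous_const))
  -- Density is applied to a neighbourhood centred at `X`; its conditions are symmetric, so the
  -- sample found there has `X` in its own neighbourhood.
  have hcover : 𝒦 ⊆ ⋃ k, U k := by
    intro X hX
    have hV : IsOpen {Y : BVPath T | ‖X.1 - Y.1‖ < η ∧ sigDist t M X Y < η ∧
        ‖signature t M Y - signature t M X‖ < δ} :=
      (isOpen_lt (continuous_const.sub continuous_subtype_val).norm continuous_const).inter
        ((isOpen_lt (continuous_sigDist t M _) continuous_const).inter
          (isOpen_lt ((continuous_signature t M).sub continuous_const).norm continuous_const))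
    obtain ⟨_, ⟨h1, h2, h3⟩, k, rfl⟩ := mem_closure_iff.1 (hdense hX) _ hV
      ⟨by simpa using hη, by simpa [sigDist] using hη, by simpa using hδ0⟩
    refine mem_iUnion.2 ⟨k, h1, ?_, h3⟩
    simpa only [sigDist, abs_sub_comm] using h2
  obtain ⟨s, hs⟩ := h𝒦.elim_finite_subcover U hUo hcover
  refine ⟨max N₁ (s.sup id), fun K hK L hL X hX => ?_⟩
  obtain ⟨k, hks, h1, h2, h3⟩ := mem_iUnion₂.1 (hs hX)
  have hkK : k ≤ K := (Finset.le_sup (f := id) hks).trans ((le_max_right _ _).trans hK)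
  refine ⟨k, hkK, h1.le, h2.le, ?_⟩
  have hLk : ∀ j ≤ N₁, |sigPair L (signature t M (S j))| ≤ 1 + D := fun j hj => by
    have h4 := hL j (hj.trans ((le_max_left _ _).trans hK))
    have h5 := hD _ (hS j)
    rw [approxError] at h4
    rw [Real.norm_eq_abs] at h5
    have h4' := abs_le.1 h4
    have h5' := abs_le.1 h5
    exact abs_le.2 ⟨by linarith, by linarith⟩
  have h6 := hbound L (1 + D) hLk _ (W.sub_mem (hmem _ (hS k)) (hmem X hX))
  refine h6.trans ?_
  calc A * (1 + D) * ‖signature t M (S k) - signature t M X‖ ≤ (A * (1 + D) + 1) * δ := by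
        gcongr
        · linarith
    _ = η := mul_div_cancel₀ _ hpos.ne'

/-- A level that grows slowly enough for a sequence of thresholds. -/
theorem exists_slow_level (N : ℕ → ℕ) :
    ∃ M₀ : ℕ → ℕ, Tendsto M₀ atTop atTop ∧ ∀ᶠ K in atTop, N (M₀ K) ≤ K := by
  refine ⟨fun K => Nat.findGreatest (fun m => N m ≤ K) K, ?_, ?_⟩
  · refine tendsto_atTop.2 fun b => ?_
    filter_upwards [eventually_ge_atTop b, eventually_ge_atTop (N b)] with K h1 h2
    exact Nat.le_findGreatest h1 h2
  -- `Nat.findGreatest` defaults to `0` when nothing qualifies; `K ≥ N 0` ensures that `0`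
  -- qualifies.
  · filter_upwards [eventually_ge_atTop (N 0)] with K hK
    exact Nat.findGreatest_spec (P := fun m => N m ≤ K) (Nat.zero_le K) hK

theorem exists_consistent_level (t : Icc (0 : ℝ) T) {𝒦 : Set (BVPath T)} (h𝒦 : IsCompact 𝒦)
    {S : ℕ → BVPath T} (hS : ∀ k, S k ∈ 𝒦) (hdense : 𝒦 ⊆ closure (range S)) :
    ∃ M₀ : ℕ → ℕ, Tendsto M₀ atTop atTop ∧
      ∀ M : ℕ → ℕ, (∀ K, M K ≤ M₀ K) →
      ∀ L : (K : ℕ) → SigWord (M K) → ℝ,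
        (∀ ε > 0, ∀ᶠ K in atTop, ∀ k ≤ K, approxError t (M K) (L K) (S k) ≤ ε) →
        ∀ ε > 0, ∀ᶠ K in atTop, ∀ X ∈ 𝒦,
          approxError t (M K) (L K) X ≤ ε ∧
          ∃ k ≤ K,
            2 * ‖X.1 - (S k).1‖ + approxError t (M K) (L K) (S k)
              + |sigPair (L K) (signature t (M K) (S k) - signature t (M K) X)| ≤ ε ∧
            sigDist t (M K) (S k) X ≤ ε := by
  have h (m n : ℕ) := exists_close_sample t h𝒦 hS hdense m (Nat.one_div_pos_of_nat (α := ℝ) (n := n))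
  choose N hN using h
  -- The supremum over `m ≤ n` serves every level below `M₀ K`, and the tolerance `1 / (M₀ K + 1)`
  -- shrinks as `M₀` grows.
  obtain ⟨M₀, hM₀, hK₀⟩ := exists_slow_level fun n => (Finset.range (n + 1)).sup fun m => N m n
  refine ⟨M₀, hM₀, fun M hM L hL ε hε => ?_⟩
  have hsmall := (tendsto_one_div_add_atTop_nhds_zero_nat (𝕜 := ℝ)).comp hM₀
  filter_upwards [hK₀, hL 1 one_pos, hL (ε / 4) (by positivity),
    hsmall.eventually_lt_const (show (0 : ℝ) < ε / 4 by positivity)] with K h1 h2 h3 h4 X hX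
  simp only [Function.comp_apply] at h4
  have hNK : N (M K) (M₀ K) ≤ K :=
    (Finset.le_sup (f := fun m => N m (M₀ K))
      (Finset.mem_range.2 (Nat.lt_succ_of_le (hM K)))).trans h1
  obtain ⟨k, hk, h5, h6, h7⟩ := hN (M K) (M₀ K) K hNK (L K) h2 X hX
  have h8 := h3 k hk
  -- The distance term contributes at most `ε / 2`, the other two at most `ε / 4` each.
  have h9 : 2 * ‖X.1 - (S k).1‖ + approxError t (M K) (L K) (S k)
      + |sigPair (L K) (signature t (M K) (S k) - signature t (M K) X)| ≤ ε := by linarith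
  exact ⟨(approxError_le t (M K) (L K) X (S k)).trans h9, k, hk, h9, by linarith⟩

end Consistency

theorem proposition4p1 (T : ℝ) (hT : 0 < T) (t : Icc (0 : ℝ) T)
    (𝒦 : Set (BVPath T)) (h𝒦 : IsCompact 𝒦)
    (S : ℕ → BVPath T) (hS : ∀ k, S k ∈ 𝒦) (hdense : 𝒦 ⊆ closure (range S)) :
    -- the three-term bound, for any path, any level, any coefficients and any sample path
    (∀ (X : BVPath T) (M : ℕ) (L : SigWord M → ℝ) (k : ℕ),
      approxError t M L X ≤ 2 * ‖X.1 - (S k).1‖ + approxError t M L (S k)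
          + |sigPair L (signature t M (S k) - signature t M X)| ∧
      |sigPair L (signature t M (S k) - signature t M X)|
        ≤ ∑ w, |L w| * |signature t M (S k) w - signature t M X w|) ∧
    -- along any levels tending to infinity there are uniformly accurate coefficients
    (∀ M : ℕ → ℕ, Tendsto M atTop atTop →
      ∃ L : (K : ℕ) → SigWord (M K) → ℝ,
        ∀ ε > 0, ∀ᶠ K in atTop, ∀ X ∈ 𝒦, approxError t (M K) (L K) X ≤ ε) ∧
    -- consistency: if the level grows slowly enough, then for all coefficients fitted on the
    -- first samples the three terms, hence the error at any path, tend to zero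
    (∃ M₀ : ℕ → ℕ, Tendsto M₀ atTop atTop ∧
      ∀ M : ℕ → ℕ, (∀ K, M K ≤ M₀ K) →
      ∀ L : (K : ℕ) → SigWord (M K) → ℝ,
        (∀ ε > 0, ∀ᶠ K in atTop, ∀ k ≤ K, approxError t (M K) (L K) (S k) ≤ ε) →
        ∀ ε > 0, ∀ᶠ K in atTop, ∀ X ∈ 𝒦,
          approxError t (M K) (L K) X ≤ ε ∧
          ∃ k ≤ K,
            2 * ‖X.1 - (S k).1‖ + approxError t (M K) (L K) (S k)
              + |sigPair (L K) (signature t (M K) (S k) - signature t (M K) X)| ≤ ε ∧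
            sigDist t (M K) (S k) X ≤ ε) := by
  refine ⟨fun X M L k => ⟨approxError_le t M L X (S k), abs_sigPair_le _ _⟩, fun M hM => ?_,
    exists_consistent_level t h𝒦 hS hdense⟩
  exact exists_accurate_coefficients t h𝒦 ⟨_, hS 0⟩ hM
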